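/- Let $P\subset\mathbb{R}^n$ be a convex polytope, i.e. the convex hull of finitely many points, and let $d=\dim P$ be the dimension of its affine hull (with $\dim\emptyset=-1$). A face of $P$ is the empty set or the set of all points of $P$ at which some linear functional attains its maximum over $P$; the vertices are the faces of dimension $0$ and the facets are the faces of dimension $d-1$. A vertex-facet assignment of $P$ is a matching in the bipartite graph whose partition classes are (disjoint copies of) the set of vertices and the set of facets of $P$, and in which a vertex $v$ and a facet $F$ are adjacent if and only if $v\notin F$, such that the matching covers all vertices or all facets (or both). If $d\le 6$, then $P$ has a vertex-facet assignment. -/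

import Mathlib

namespace PolytopeAssignment

variable {E : Type*} [NormedAddCommGroup E] [NormedSpace ℝ E]

/-- A convex polytope: the convex hull of finitely many points. -/
def IsPolytope (P : Set E) : Prop :=
  ∃ S : Set E, S.Finite ∧ P = convexHull ℝ S

open Classical in
/-- The dimension of a convex set: the dimension of its affine hull, with `dim ∅ = -1`. -/
noncomputable def dim (A : Set E) : ℤ :=
  if A = ∅ then -1 else (Module.finrank ℝ (vectorSpan ℝ A) : ℤ)

/-- The faces of dimension `k` of `P`. A face is the empty set or the set of maximizers over `P`
of some linear functional (the zero functional yields the face `P`); this is `IsExposed`. -/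
def faces (P : Set E) (k : ℤ) : Set (Set E) :=
  {F | IsExposed ℝ P F ∧ dim F = k}

/-- The vertices of `P`, as `0`-dimensional faces. -/
abbrev vertices (P : Set E) : Set (Set E) := faces P 0

/-- The facets of `P`: the faces of dimension `dim P - 1`. -/
abbrev facets (P : Set E) : Set (Set E) := faces P (dim P - 1)

/-- The vertex-facet graph: the bipartite graph on disjoint copies of the vertices and of the
facets of `P`, a vertex and a facet being adjacent iff they are not incident in `P`. -/
def vertexFacetGraph (P : Set E) : SimpleGraph (vertices P ⊕ facets P) where
  Adj
    | Sum.inl v, Sum.inr F => ¬ (v : Set E) ⊆ (F : Set E)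
    | Sum.inr F, Sum.inl v => ¬ (v : Set E) ⊆ (F : Set E)
    | Sum.inl _, Sum.inl _ => False
    | Sum.inr _, Sum.inr _ => False
  symm := ⟨by rintro (v | F) (w | G) h <;> exact h⟩
  loopless := ⟨by rintro (v | F) h <;> exact h⟩

/-- `P` has a vertex-facet assignment: a matching of the vertex-facet graph that covers all
vertices or all facets. -/
def HasVertexFacetAssignment (P : Set E) : Prop :=
  ∃ M : (vertexFacetGraph P).Subgraph, M.IsMatching ∧
    ((∀ v : vertices P, Sum.inl v ∈ M.verts) ∨ (∀ F : facets P, Sum.inr F ∈ M.verts))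

end PolytopeAssignment

/-!
A polytope `P` of dimension `d` is encoded by its slack matrix `M`, of rank at most `d + 1 ≤ 7`:
the rows are indexed by the vertices, the columns by the facets, and `M v F` is the value at `v`
of an affine functional that is nonnegative on `P` and vanishes exactly on `F`
(`IsPolytope.exists_slackMatrix`). An assignment is a transversal of nonzero entries that uses all
rows or all columns, so Hall's theorem applies, to the rows if there are at most as many rows as
columns, and to the columns otherwise.

Hall's condition concerns a set `A` of rows and the set `B` of columns that vanish on `A`. As the
block `A × B` is zero, the ranks of `A` and of `B` add up to at most `7`
(`finrank_span_add_finrank_span_le_rank`), so one of them is at most `3`. If it is the rank of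
`A`, then `|A| ≤ |Bᶜ|` (`HasExtremeRows.card_le_card_compl`), which is Hall's condition. Indeed,
if the rank is `3`, then the vertices in `A` lie in a plane. Through each of them pass at least
two facets that do not contain all of `A`, since the facets through a vertex have no other point
in common with the plane, and each such facet meets the plane within a line, which contains at
most two vertices. If it is the rank of `B` that is at most `3`, the same argument for the
transposed matrix gives `|B| ≤ |Aᶜ|`, that is, `|A| + |B|` is at most the number of rows, hence at
most the number of columns, which is Hall's condition again.

The argument is symmetric because vertices and facets enter only through `HasExtremeRows`, which
holds for `M` and for its transpose. For the transpose it says that the vertices of a facet span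
it. For `M` it says that a vertex is cut out by the facets through it, which rests on
`exists_isFacetFunctional`: whatever can be separated from a finitely generated cone, within its
span, can be separated by a facet.
-/

namespace PolytopeAssignment

/-! ### Extreme rows of a nonnegative matrix -/

/-- The rows of a nonnegative matrix are *extreme* if they are nonzero, pairwise non-proportional,
and each of them spans the space of those vectors of the row space that vanish wherever it does.
For a slack matrix of a polytope, with rows indexed by vertices, this says that the vertices are
distinct and each is cut out by the facets through it. -/
structure HasExtremeRows {V F : Type*} (M : V → F → ℝ) : Prop where
  nonneg : ∀ v f, 0 ≤ M v f
  ne_zero : ∀ v, M v ≠ 0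
  injective : ∀ u v (c : ℝ), M u = c • M v → u = v
  extreme : ∀ v, ∀ x ∈ Submodule.span ℝ (Set.range M), (∀ f, M v f = 0 → x f = 0) →
    ∃ c : ℝ, x = c • M v

namespace HasExtremeRows

variable {V F : Type*} {M : V → F → ℝ}

/-- In a nontrivial linear relation between extreme rows, at least two coefficients are negative. -/
lemma eq_zero_of_sum_smul_eq_zero (h : HasExtremeRows M) {T : Finset V} {a : V → ℝ} {v : V}
    (hv : v ∈ T) (ha : ∀ t ∈ T, t ≠ v → 0 ≤ a t) (hsum : ∑ t ∈ T, a t • M t = 0) :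
    ∀ t ∈ T, a t = 0 := by
  classical
  have hsum' := Finset.add_sum_erase T (fun t => a t • M t) hv
  have key : ∀ t ∈ T, t ≠ v → a t = 0 := by
    intro t ht htv
    by_contra hat
    refine htv ?_
    have hz : ∀ f, M v f = 0 → M t f = 0 := by
      intro f hf
      have h1 : ∑ t ∈ T.erase v, a t * M t f = 0 := by
        have := congrFun (hsum'.trans hsum) f
        simpa [hf, Finset.sum_apply] using this
      have h2 := (Finset.sum_eq_zero_iff_of_nonneg (fun s hs => mul_nonneg
        (ha s (Finset.mem_of_mem_erase hs) (Finset.ne_of_mem_erase hs)) (h.nonneg s f))).1 h1 t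
        (Finset.mem_erase.2 ⟨htv, ht⟩)
      exact (mul_eq_zero.1 h2).resolve_left hat
    obtain ⟨c, hc⟩ := h.extreme v (M t) (Submodule.subset_span ⟨t, rfl⟩) hz
    exact h.injective t v c hc
  intro t ht
  by_cases htv : t = v
  · subst htv
    have h0 : ∑ s ∈ T.erase t, a s • M s = 0 := Finset.sum_eq_zero fun s hs => by
      rw [key s (Finset.mem_of_mem_erase hs) (Finset.ne_of_mem_erase hs), zero_smul]
    have h1 : a t • M t = 0 := by
      have := hsum'.trans hsum
      rwa [h0, add_zero] at this
    exact (smul_eq_zero.1 h1).resolve_right (h.ne_zero t)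
  · exact key t ht htv

/-- At most three extreme rows are linearly independent: among three coefficients, one sign
occurs at most once. -/
lemma linearIndepOn (h : HasExtremeRows M) {T : Finset V} (hT : T.card ≤ 3) :
    LinearIndepOn ℝ M (T : Set V) := by
  classical
  rw [linearIndepOn_finset_iff]
  intro a hsum
  rcases T.eq_empty_or_nonempty with rfl | ⟨v₀, hv₀⟩
  · simp
  have aux : ∀ b : V → ℝ, ∑ t ∈ T, b t • M t = 0 → (T.filter (fun t => b t < 0)).card ≤ 1 →
      ∀ t ∈ T, b t = 0 := by
    intro b hb hcard
    rcases (T.filter (fun t => b t < 0)).eq_empty_or_nonempty with he | ⟨v, hv⟩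
    · refine h.eq_zero_of_sum_smul_eq_zero hv₀ (fun t ht _ => ?_) hb
      by_contra hlt
      have : t ∈ T.filter (fun t => b t < 0) := Finset.mem_filter.2 ⟨ht, not_le.1 hlt⟩
      simp [he] at this
    · refine h.eq_zero_of_sum_smul_eq_zero (Finset.mem_filter.1 hv).1 (fun t ht htv => ?_) hb
      by_contra hlt
      exact htv (Finset.card_le_one.1 hcard t (Finset.mem_filter.2 ⟨ht, not_le.1 hlt⟩) v hv)
  have hdisj : Disjoint (T.filter (fun t => a t < 0)) (T.filter (fun t => -a t < 0)) := by
    rw [Finset.disjoint_filter]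
    intro t _ h1 h2
    linarith
  have hcard := Finset.card_union_of_disjoint hdisj
  have hle : (T.filter (fun t => a t < 0) ∪ T.filter (fun t => -a t < 0)).card ≤ T.card :=
    Finset.card_le_card (Finset.union_subset (Finset.filter_subset _ _) (Finset.filter_subset _ _))
  by_cases h1 : (T.filter (fun t => a t < 0)).card ≤ 1
  · exact aux a hsum h1
  · have := aux (fun t => -a t) (by simp [hsum]) (by omega)
    exact fun t ht => neg_eq_zero.1 (this t ht)

/-- A subspace of dimension at most two contains no more extreme rows than its dimension. -/
lemma card_le_finrank [Finite F] (h : HasExtremeRows M) {T : Finset V}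
    {U : Submodule ℝ (F → ℝ)} (hTU : ∀ t ∈ T, M t ∈ U) (hU : Module.finrank ℝ U ≤ 2) :
    T.card ≤ Module.finrank ℝ U := by
  by_contra! hlt
  obtain ⟨S, hST, hS⟩ := Finset.exists_subset_card_eq (Nat.succ_le_of_lt hlt)
  have hli : LinearIndependent ℝ (fun s : S => M s) := h.linearIndepOn (T := S) (by omega)
  have hli' : LinearIndependent ℝ (fun s : S => (⟨M s, hTU s (hST s.2)⟩ : U)) :=
    LinearIndependent.of_comp U.subtype hli
  have := hli'.fintype_card_le_finrank
  simp only [Fintype.card_coe] at this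
  omega

/-- If a set `A` of extreme rows has rank at most three and vanishes on the columns in `B`, then
the complement of `B` is at least as large as `A`. For rank three this is a double count, as for
the vertices and edges of a polygon: each row of `A` vanishes on at least two of the columns that
do not vanish on `A`, and each such column vanishes on at most two rows of `A`. -/
lemma card_le_card_compl [Fintype F] [DecidableEq F] (h : HasExtremeRows M) {A : Finset V}
    {B : Finset F} (hAB : ∀ v ∈ A, ∀ f ∈ B, M v f = 0)
    (hA : Module.finrank ℝ (Submodule.span ℝ (M '' (A : Set V))) ≤ 3) :
    A.card ≤ Bᶜ.card := by
  classical
  set W := Submodule.span ℝ (M '' (A : Set V)) with hW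
  have hmem : ∀ v ∈ A, M v ∈ W := fun v hv => Submodule.subset_span ⟨v, hv, rfl⟩
  have hWle : W ≤ Submodule.span ℝ (Set.range M) :=
    Submodule.span_mono (Set.image_subset_range _ _)
  rcases A.eq_empty_or_nonempty with rfl | ⟨v₀, hv₀⟩
  · simp
  by_cases hr1 : Module.finrank ℝ W ≤ 1
  · refine (h.card_le_finrank hmem (by omega)).trans (hr1.trans (Finset.card_pos.2 ?_))
    obtain ⟨f, hf⟩ := Function.ne_iff.1 (h.ne_zero v₀)
    exact ⟨f, Finset.mem_compl.2 fun hfB => hf (hAB v₀ hv₀ f hfB)⟩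
  set r := Module.finrank ℝ W with hr
  set F' : Finset F := Finset.univ.filter (fun f => ∃ v ∈ A, M v f ≠ 0) with hF'
  have hF'B : F'.card ≤ Bᶜ.card := Finset.card_le_card fun f hf => by
    obtain ⟨v, hv, hvf⟩ := (Finset.mem_filter.1 hf).2
    exact Finset.mem_compl.2 fun hfB => hvf (hAB v hv f hfB)
  have hzero : ∀ f ∉ F', ∀ x ∈ W, x f = 0 := by
    intro f hf x hx
    have : W ≤ LinearMap.ker (LinearMap.proj f : (F → ℝ) →ₗ[ℝ] ℝ) := by
      rw [hW, Submodule.span_le]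
      rintro _ ⟨v, hv, rfl⟩
      by_contra hne
      exact hf (Finset.mem_filter.2 ⟨Finset.mem_univ _, v, hv, hne⟩)
    exact this hx
  refine le_trans ?_ hF'B
  have hcount := Finset.card_mul_le_card_mul (s := A) (t := F') (m := r - 1) (n := r - 1)
    (fun v f => M v f = 0) ?_ ?_
  · exact Nat.le_of_mul_le_mul_right hcount (by omega)
  · -- The columns of `F'` vanishing at `v` cut out the line through `M v` in `W`.
    intro v hv
    set T := Finset.bipartiteAbove (fun v f => M v f = 0) F' v with hT
    let φ : W →ₗ[ℝ] (T → ℝ) := (LinearMap.funLeft ℝ ℝ (fun t : T => (t : F))).comp W.subtype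
    have hker : Module.finrank ℝ (LinearMap.ker φ) ≤ 1 := by
      refine finrank_le_one ⟨⟨M v, hmem v hv⟩, ?_⟩ ?_
      · refine LinearMap.mem_ker.2 (funext fun t => ?_)
        exact ((Finset.mem_bipartiteAbove _).1 t.2).2
      · rintro ⟨⟨x, hxW⟩, hx⟩
        obtain ⟨c, hc⟩ := h.extreme v x (hWle hxW) fun f hf => by
          by_cases hfF : f ∈ F'
          · exact congrFun (LinearMap.mem_ker.1 hx)
              ⟨f, (Finset.mem_bipartiteAbove _).2 ⟨hfF, hf⟩⟩
          · exact hzero f hfF x hxW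
        exact ⟨c, Subtype.ext (Subtype.ext hc.symm)⟩
    have h1 := LinearMap.finrank_range_add_finrank_ker φ
    have h2 := Submodule.finrank_le (LinearMap.range φ)
    simp only [Module.finrank_fintype_fun_eq_card, Fintype.card_coe] at h2
    omega
  · intro f hf
    obtain ⟨v, hv, hvf⟩ := (Finset.mem_filter.1 hf).2
    set U : Submodule ℝ (F → ℝ) := W ⊓ LinearMap.ker (LinearMap.proj f : (F → ℝ) →ₗ[ℝ] ℝ) with hU
    have hlt : Module.finrank ℝ U < r := Submodule.finrank_lt_finrank_of_lt
      (lt_of_le_of_ne inf_le_left fun he => hvf (by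
        have : M v ∈ U := he ▸ hmem v hv
        exact this.2))
    have := h.card_le_finrank (T := Finset.bipartiteBelow (fun v f => M v f = 0) A f) (U := U)
      (fun t ht => by
        obtain ⟨htA, htf⟩ := (Finset.mem_bipartiteBelow _).1 ht
        exact ⟨hmem t htA, htf⟩) (by omega)
    omega

end HasExtremeRows

/-! ### Matchings from a matrix of rank at most seven -/

/-- If the block `A × B` of a matrix vanishes, then the rows in `A` and the columns in `B` have
total rank at most the rank of the matrix. -/
lemma finrank_span_add_finrank_span_le_rank {V F : Type*} [Fintype V] [Fintype F]
    (M : V → F → ℝ) {A : Finset V} {B : Finset F} (hAB : ∀ v ∈ A, ∀ f ∈ B, M v f = 0) :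
    Module.finrank ℝ (Submodule.span ℝ (M '' (A : Set V))) +
      Module.finrank ℝ (Submodule.span ℝ ((fun f v => M v f) '' (B : Set F))) ≤
        (Matrix.of M).rank := by
  classical
  set R := Submodule.span ℝ (Set.range M) with hR
  have hrank : (Matrix.of M).rank = Module.finrank ℝ R := (Matrix.of M).rank_eq_finrank_span_row
  let ρ : (F → ℝ) →ₗ[ℝ] (B → ℝ) := LinearMap.funLeft ℝ ℝ (fun f : B => (f : F))
  have hcols : Module.finrank ℝ (Submodule.span ℝ ((fun f v => M v f) '' (B : Set F))) =
      Module.finrank ℝ (LinearMap.range (ρ.domRestrict R)) := by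
    have h1 : (Matrix.submatrix (Matrix.of M) id (fun f : B => (f : F))).rank =
        Module.finrank ℝ (Submodule.span ℝ ((fun f v => M v f) '' (B : Set F))) := by
      rw [Matrix.rank_eq_finrank_span_cols]
      suffices hs : Set.range (Matrix.submatrix (Matrix.of M) id (fun f : B => (f : F))).col =
          (fun f v => M v f) '' (B : Set F) by rw [hs]
      ext x
      constructor
      · rintro ⟨f, rfl⟩
        exact ⟨f, f.2, rfl⟩
      · rintro ⟨f, hf, rfl⟩
        exact ⟨⟨f, hf⟩, rfl⟩
    rw [← h1, Matrix.rank_eq_finrank_span_row, LinearMap.range_domRestrict, hR,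
      Submodule.map_span, ← Set.range_comp]
    rfl
  have hker : Module.finrank ℝ (Submodule.span ℝ (M '' (A : Set V))) ≤
      Module.finrank ℝ (LinearMap.ker (ρ.domRestrict R)) := by
    have hle : Submodule.span ℝ (M '' (A : Set V)) ≤ R :=
      Submodule.span_mono (Set.image_subset_range _ _)
    have hle' : Submodule.span ℝ (M '' (A : Set V)) ≤ LinearMap.ker ρ := by
      rw [Submodule.span_le]
      rintro _ ⟨v, hv, rfl⟩
      exact LinearMap.mem_ker.2 (funext fun f => hAB v hv f f.2)
    refine LinearMap.finrank_le_finrank_of_injective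
      (f := (Submodule.inclusion hle).codRestrict _ fun x => hle' x.2) ?_
    intro x y hxy
    exact Submodule.inclusion_injective hle (congrArg Subtype.val hxy)
  have := LinearMap.finrank_range_add_finrank_ker (ρ.domRestrict R)
  omega

/-- A matrix of rank at most seven with extreme rows and extreme columns, and no more rows than
columns, has a transversal of nonzero entries that covers all rows. -/
lemma exists_injective_of_card_le {V F : Type*} [Fintype V] [Fintype F] {M : V → F → ℝ}
    (hrow : HasExtremeRows M) (hcol : HasExtremeRows (fun f v => M v f))
    (hrank : (Matrix.of M).rank ≤ 7)
    (hcard : Fintype.card V ≤ Fintype.card F) :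
    ∃ φ : V → F, Function.Injective φ ∧ ∀ v, M v (φ v) ≠ 0 := by
  classical
  rw [← Fintype.all_card_le_filter_rel_iff_exists_injective (fun v f => M v f ≠ 0)]
  intro A
  set B : Finset F := Finset.univ.filter (fun f => ∀ v ∈ A, M v f = 0) with hB
  have hAB : ∀ v ∈ A, ∀ f ∈ B, M v f = 0 := fun v hv f hf => (Finset.mem_filter.1 hf).2 v hv
  have hN : Finset.univ.filter (fun f => ∃ v ∈ A, M v f ≠ 0) = Bᶜ := by
    ext f
    simp [hB]
  rw [hN]
  have hsum := (finrank_span_add_finrank_span_le_rank M hAB).trans hrank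
  by_cases hA : Module.finrank ℝ (Submodule.span ℝ (M '' (A : Set V))) ≤ 3
  · exact hrow.card_le_card_compl hAB hA
  · have h1 := hcol.card_le_card_compl (A := B) (B := A) (fun f hf v hv => hAB v hv f hf)
      (by omega)
    have h2 := Finset.card_compl_add_card A
    have h3 := Finset.card_compl_add_card B
    omega

open Module (Dual)

/-! ### Facet functionals of a finitely generated cone -/

section Cone

variable {X : Type*} [AddCommGroup X] [Module ℝ X]

/-- A functional defines a facet of the cone generated by `S` if it is nonnegative on `S`, does
not vanish on `S`, and is determined up to a factor, as a function on `S`, by its zeros in `S`.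
The last condition says that these zeros span a hyperplane of the span of `S`; no dimension needs
to be mentioned. -/
structure IsFacetFunctional (S : Set X) (g : Dual ℝ X) : Prop where
  nonneg : ∀ s ∈ S, 0 ≤ g s
  ne_zero : ∃ s ∈ S, g s ≠ 0
  unique : ∀ h : Dual ℝ X, (∀ s ∈ S, g s = 0 → h s = 0) → ∃ c : ℝ, ∀ s ∈ S, h s = c * g s

/-- A linear combination of generators that some functional nonnegative on `S` separates from the
cone is separated from it by a facet functional, which can be chosen to keep the zeros of the
given functional. Take a separating functional whose set of zeros in `S` is maximal: if these zeros
did not determine it, it could be tilted about them and about `q` until it gains another zero. -/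
lemma exists_isFacetFunctional {S : Set X} (hS : S.Finite) {q : X} (hq : q ∈ Submodule.span ℝ S)
    {f : Dual ℝ X} (hf : ∀ s ∈ S, 0 ≤ f s) (hfq : f q < 0) :
    ∃ g, IsFacetFunctional S g ∧ (∀ s ∈ S, f s = 0 → g s = 0) ∧ g q < 0 := by
  classical
  let Adm : Set (Dual ℝ X) :=
    {g | (∀ s ∈ S, 0 ≤ g s) ∧ (∀ s ∈ S, f s = 0 → g s = 0) ∧ g q < 0}
  let Z : Dual ℝ X → Set X := fun g => {s ∈ S | g s = 0}
  have himg : (Z '' Adm).Finite := hS.finite_subsets.subset (by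
    rintro _ ⟨g, -, rfl⟩
    exact fun s hs => hs.1)
  obtain ⟨-, ⟨g, ⟨hg0, hgf, hgq⟩, rfl⟩, hmax⟩ :=
    himg.exists_maximalFor id _ ⟨Z f, f, ⟨hf, fun _ _ h => h, hfq⟩, rfl⟩
  refine ⟨g, ⟨hg0, ?_, ?_⟩, hgf, hgq⟩
  · by_contra! hne
    have hle : Submodule.span ℝ S ≤ LinearMap.ker g := Submodule.span_le.2 hne
    exact hgq.ne (hle hq)
  -- A functional that vanishes on the zeros of `g` and at `q` is nonnegative on `S`.
  -- Applied to its negative as well, this shows that it vanishes on `S`.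
  have key : ∀ k : Dual ℝ X, (∀ s ∈ S, g s = 0 → k s = 0) → k q = 0 → ∀ s ∈ S, 0 ≤ k s := by
    intro k hk hkq s₀ hs₀
    by_contra! hlt
    -- Among the generators where `k` is negative, `s` is where `g + τ • k` first reaches zero.
    obtain ⟨s, ⟨hs, hks⟩, hmin⟩ :=
      (hS.subset (Set.sep_subset S (fun s => k s < 0))).exists_minimalFor (fun s => g s / -k s) _ ⟨s₀, hs₀, hlt⟩
    have hmin' : ∀ t ∈ S, k t < 0 → g s / -k s ≤ g t / -k t := fun t ht hkt => by
      rcases le_total (g s / -k s) (g t / -k t) with h | h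
      · exact h
      · exact hmin ⟨ht, hkt⟩ h
    set τ := g s / -k s with hτ
    have hτ0 : 0 ≤ τ := div_nonneg (hg0 s hs) (by linarith)
    have hadm : g + τ • k ∈ Adm := by
      refine ⟨fun t ht => ?_, fun t ht hft => ?_, ?_⟩
      · rcases lt_or_ge (k t) 0 with hkt | hkt
        · have := (le_div_iff₀ (by linarith : 0 < -k t)).1 (hmin' t ht hkt)
          simp only [LinearMap.add_apply, LinearMap.smul_apply, smul_eq_mul]
          linarith
        · have := mul_nonneg hτ0 hkt
          have := hg0 t ht
          simp only [LinearMap.add_apply, LinearMap.smul_apply, smul_eq_mul]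
          linarith
      · simp [hgf t ht hft, hk t ht (hgf t ht hft)]
      · simpa [hkq] using hgq
    have hsub : Z g ⊆ Z (g + τ • k) := fun t ht => ⟨ht.1, by simp [ht.2, hk t ht.1 ht.2]⟩
    have hmem : s ∈ Z (g + τ • k) := ⟨hs, by
      simp only [LinearMap.add_apply, LinearMap.smul_apply, smul_eq_mul]
      rw [hτ, div_neg, neg_mul, div_mul_cancel₀ _ hks.ne, add_neg_cancel]⟩
    have hsZ : s ∈ Z g := hmax ⟨_, hadm, rfl⟩ hsub hmem
    exact hks.ne (hk s hs hsZ.2)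
  intro h hh
  refine ⟨h q / g q, fun s hs => ?_⟩
  have hk1 : ∀ s ∈ S, g s = 0 → (h - (h q / g q) • g) s = 0 := fun s hs hgs => by
    simp [hgs, hh s hs hgs]
  have hkq : (h - (h q / g q) • g) q = 0 := by
    have := hgq.ne
    simp only [LinearMap.sub_apply, LinearMap.smul_apply, smul_eq_mul]
    field_simp
    ring
  have h1 := key _ hk1 hkq s hs
  have h2 := key (-(h - (h q / g q) • g)) (fun s hs hgs => by
    rw [LinearMap.neg_apply, hk1 s hs hgs, neg_zero]) (by rw [LinearMap.neg_apply, hkq, neg_zero])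
    s hs
  simp only [LinearMap.sub_apply, LinearMap.smul_apply, smul_eq_mul, LinearMap.neg_apply] at h1 h2
  linarith

/-- An extreme ray of a finitely generated cone is cut out by the facets through it: if every
facet functional that vanishes at `v` vanishes at `q`, then `q` is a multiple of `v`. -/
lemma exists_eq_smul_of_forall_isFacetFunctional {S : Set X} (hS : S.Finite) {v : X}
    {f : Dual ℝ X} (hf : ∀ s ∈ S, s ≠ v → 0 < f s) (hfv : f v = 0)
    {q : X} (hq : q ∈ Submodule.span ℝ S)
    (h : ∀ g, IsFacetFunctional S g → g v = 0 → g q = 0) (hv : v ∈ S) : ∃ c : ℝ, q = c • v := by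
  by_contra hne
  have hqv : q ∉ Submodule.span ℝ {v} := fun hmem => by
    obtain ⟨c, hc⟩ := Submodule.mem_span_singleton.1 hmem
    exact hne ⟨c, hc.symm⟩
  obtain ⟨k, hkq, hk⟩ := Submodule.exists_le_ker_of_notMem hqv
  have hkv : k v = 0 := hk (Submodule.mem_span_singleton_self v)
  -- Tilting the supporting functional `f` by a small multiple of `k` makes it strict at `p = ± q`.
  have aux : ∀ p ∈ Submodule.span ℝ S, f p ≤ 0 → k p ≠ 0 →
      (∀ g, IsFacetFunctional S g → g v = 0 → g p = 0) → False := by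
    intro p hp hfp hkp hgp
    obtain ⟨k', hk'v, hk'p⟩ : ∃ k' : Dual ℝ X, k' v = 0 ∧ k' p < 0 := by
      rcases lt_or_gt_of_ne hkp with hlt | hgt
      · exact ⟨k, hkv, hlt⟩
      · exact ⟨-k, by simp [hkv], by simpa using hgt⟩
    have hε : ∃ ε > 0, ∀ s ∈ S, 0 ≤ f s + ε * k' s := by
      have hev : ∀ s ∈ S, ∀ᶠ ε in nhdsWithin (0 : ℝ) (Set.Ioi 0), 0 ≤ f s + ε * k' s := by
        intro s hs
        by_cases hsv : s = v
        · simp [hsv, hfv, hk'v]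
        · have hcont : Filter.Tendsto (fun ε : ℝ => f s + ε * k' s) (nhds 0)
              (nhds (f s + 0 * k' s)) := Continuous.tendsto (by fun_prop) 0
          refine (hcont.mono_left nhdsWithin_le_nhds).eventually (Filter.Eventually.mono
            (lt_mem_nhds ?_) fun _ h => h.le)
          simpa using hf s hs hsv
      obtain ⟨ε, hε1, hε2⟩ := (((Set.Finite.eventually_all hS).2 hev).and
        self_mem_nhdsWithin).exists
      exact ⟨ε, hε2, hε1⟩
    obtain ⟨ε, hε0, hε⟩ := hε
    obtain ⟨g, hg, hgz, hglt⟩ := exists_isFacetFunctional hS hp (f := f + ε • k')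
      (fun s hs => by simpa using hε s hs) (by
        have := mul_neg_of_pos_of_neg hε0 hk'p
        simp only [LinearMap.add_apply, LinearMap.smul_apply, smul_eq_mul]
        linarith)
    exact hglt.ne (hgp g hg (hgz v hv (by simp [hfv, hk'v])))
  rcases le_total (f q) 0 with hle | hge
  · exact aux q hq hle hkq h
  · exact aux (-q) (neg_mem hq) (by simpa using hge) (by simpa using hkq)
      fun g hg hgv => by simp [h g hg hgv]

end Cone

/-! ### Polytopes are spanned by their exposed points -/

/-- The copy of a set at height one in `E × ℝ`. Linear functionals on `E × ℝ` restrict to the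
affine functionals on this copy, so a polytope becomes a section of a finitely generated cone. -/
def homogenize {E : Type*} (S : Set E) : Set (E × ℝ) := (fun x => (x, (1 : ℝ))) '' S

lemma mem_homogenize {E : Type*} {S : Set E} {x : E} (hx : x ∈ S) :
    (x, (1 : ℝ)) ∈ homogenize S := ⟨x, hx, rfl⟩

lemma forall_mem_homogenize {E : Type*} {S : Set E} {p : E × ℝ → Prop} :
    (∀ s ∈ homogenize S, p s) ↔ ∀ x ∈ S, p (x, 1) := Set.forall_mem_image

section Faces

variable {E : Type*} [NormedAddCommGroup E] [NormedSpace ℝ E]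

lemma apply_sub_apply (g : Dual ℝ (E × ℝ)) (x y : E) : g (x, 1) - g (y, 1) = g (x - y, 0) := by
  rw [← map_sub, Prod.mk_sub_mk, sub_self]

lemma convex_setOf_nonneg (g : Dual ℝ (E × ℝ)) : Convex ℝ {x : E | 0 ≤ g (x, 1)} := by
  intro x hx y hy a b ha hb hab
  have : ((a • x + b • y, (1 : ℝ)) : E × ℝ) = a • (x, (1 : ℝ)) + b • (y, (1 : ℝ)) := by
    ext <;> simp [hab]
  simp only [Set.mem_ofPred_eq, this, map_add, map_smul, smul_eq_mul] at *
  positivity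

lemma nonneg_on_convexHull {S : Set E} {g : Dual ℝ (E × ℝ)} (h : ∀ x ∈ S, 0 ≤ g (x, 1)) :
    ∀ x ∈ convexHull ℝ S, 0 ≤ g (x, 1) :=
  fun _ hx => convexHull_min (t := {x : E | 0 ≤ g (x, 1)}) h (convex_setOf_nonneg g) hx

lemma eq_zero_on_convexHull {S : Set E} {g : Dual ℝ (E × ℝ)} (h : ∀ x ∈ S, g (x, 1) = 0) :
    ∀ x ∈ convexHull ℝ S, g (x, 1) = 0 := fun x hx =>
  le_antisymm
    (by simpa using nonneg_on_convexHull (g := -g) (fun y hy => by simp [h y hy]) x hx)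
    (nonneg_on_convexHull (fun y hy => (h y hy).ge) x hx)

lemma IsPolytope.isCompact {P : Set E} (hP : IsPolytope P) : IsCompact P := by
  obtain ⟨S, hS, rfl⟩ := hP
  exact hS.isCompact_convexHull ℝ

lemma IsPolytope.convex {P : Set E} (hP : IsPolytope P) : Convex ℝ P := by
  obtain ⟨S, hS, rfl⟩ := hP
  exact convex_convexHull ℝ S

lemma IsPolytope.finite_extremePoints {P : Set E} (hP : IsPolytope P) :
    (P.extremePoints ℝ).Finite := by
  obtain ⟨S, hS, rfl⟩ := hP
  exact hS.subset extremePoints_convexHull_subset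

lemma IsPolytope.convexHull_extremePoints_inter {P F : Set E} (hP : IsPolytope P)
    (hF : IsExposed ℝ P F) : convexHull ℝ (F ∩ P.extremePoints ℝ) = F := by
  have hcl : IsClosed (convexHull ℝ (F ∩ P.extremePoints ℝ)) :=
    (hP.finite_extremePoints.subset Set.inter_subset_right).isClosed_convexHull ℝ
  rw [← hcl.closure_eq, ← hF.isExtreme.extremePoints_eq]
  exact closure_convexHull_extremePoints (hF.isCompact hP.isCompact) (hF.convex hP.convex)

lemma IsPolytope.convexHull_extremePoints {P : Set E} (hP : IsPolytope P) :
    convexHull ℝ (P.extremePoints ℝ) = P := by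
  have := hP.convexHull_extremePoints_inter (IsExposed.refl P)
  rwa [Set.inter_eq_right.2 extremePoints_subset] at this

/-- Affine functionals that are nonnegative on a set cut out exposed subsets. -/
lemma isExposed_setOf_eq_zero [FiniteDimensional ℝ E] {P : Set E} {g : Dual ℝ (E × ℝ)}
    (hg : ∀ x ∈ P, 0 ≤ g (x, 1)) : IsExposed ℝ P {x ∈ P | g (x, 1) = 0} := by
  rintro ⟨x₀, hx₀P, hx₀⟩
  let l : E →ₗ[ℝ] ℝ := -(g ∘ₗ LinearMap.inl ℝ E ℝ)
  have hl : ∀ x y : E, l y ≤ l x ↔ g (x, 1) ≤ g (y, 1) := fun x y => by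
    have := apply_sub_apply g x y
    have h2 : g (x - y, 0) = l y - l x := by
      rw [← map_sub]
      simp [l, ← map_neg, -map_sub]
    constructor <;> intro h <;> linarith
  refine ⟨LinearMap.toContinuousLinearMap l, Set.ext fun x => ?_⟩
  simp only [Set.mem_ofPred_eq, LinearMap.coe_toContinuousLinearMap', hl]
  constructor
  · rintro ⟨hx, hx0⟩
    exact ⟨hx, fun y hy => hx0 ▸ hg y hy⟩
  · rintro ⟨hx, hmax⟩
    exact ⟨hx, le_antisymm ((hmax x₀ hx₀P).trans hx₀.le) (hg x hx)⟩

/-- Nonempty exposed subsets are cut out by affine functionals that are nonnegative on the set. -/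
lemma exists_eq_setOf_eq_zero {P F : Set E} (hF : IsExposed ℝ P F) (hne : F.Nonempty) :
    ∃ g : Dual ℝ (E × ℝ), (∀ x ∈ P, 0 ≤ g (x, 1)) ∧ F = {x ∈ P | g (x, 1) = 0} := by
  obtain ⟨x₀, hx₀⟩ := hne
  obtain ⟨l, hl⟩ := hF ⟨x₀, hx₀⟩
  have hx₀' : x₀ ∈ P ∧ ∀ y ∈ P, l y ≤ l x₀ := by rw [hl] at hx₀; exact hx₀
  refine ⟨l x₀ • LinearMap.snd ℝ E ℝ - l.toLinearMap ∘ₗ LinearMap.fst ℝ E ℝ, ?_, ?_⟩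
  · intro x hx
    simpa using hx₀'.2 x hx
  · rw [hl]
    ext x
    simp only [Set.mem_ofPred_eq, LinearMap.sub_apply, LinearMap.smul_apply, LinearMap.snd_apply,
      LinearMap.comp_apply, LinearMap.fst_apply, smul_eq_mul, mul_one, sub_eq_zero]
    constructor
    · rintro ⟨hx, hmax⟩
      exact ⟨hx, le_antisymm (hmax x₀ hx₀'.1) (hx₀'.2 x hx)⟩
    · rintro ⟨hx, heq⟩
      exact ⟨hx, fun y hy => (hx₀'.2 y hy).trans heq.le⟩

/-- Extreme points of polytopes are exposed: they can be strictly separated from the hull of the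
other extreme points. -/
lemma IsPolytope.exists_functional_of_extremePoint {P : Set E} (hP : IsPolytope P) {v : E}
    (hv : v ∈ P.extremePoints ℝ) :
    ∃ f : Dual ℝ (E × ℝ), f (v, 1) = 0 ∧ ∀ s ∈ P.extremePoints ℝ, s ≠ v → 0 < f (s, 1) := by
  have hcl : IsClosed (convexHull ℝ (P.extremePoints ℝ \ {v})) :=
    (hP.finite_extremePoints.subset Set.sdiff_subset).isClosed_convexHull ℝ
  have hnot : v ∉ convexHull ℝ (P.extremePoints ℝ \ {v}) := fun hmem =>
    (hP.convex.mem_extremePoints_iff_mem_sdiff_convexHull_sdiff.1 hv).2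
      (convexHull_mono (Set.sdiff_subset_sdiff_left extremePoints_subset) hmem)
  obtain ⟨l, u, hlv, hl⟩ := geometric_hahn_banach_point_closed (convex_convexHull ℝ _) hcl hnot
  refine ⟨l.toLinearMap ∘ₗ LinearMap.fst ℝ E ℝ - l v • LinearMap.snd ℝ E ℝ, by simp, ?_⟩
  intro s hs hsv
  have := hl s (subset_convexHull ℝ _ ⟨hs, hsv⟩)
  simp only [LinearMap.sub_apply, LinearMap.smul_apply, LinearMap.snd_apply,
    LinearMap.comp_apply, LinearMap.fst_apply, smul_eq_mul, mul_one, ContinuousLinearMap.coe_coe]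
  linarith

lemma dim_of_nonempty {A : Set E} (hA : A.Nonempty) :
    dim A = (Module.finrank ℝ (vectorSpan ℝ A) : ℤ) := by
  rw [dim, if_neg hA.ne_empty]

lemma dim_empty : dim (∅ : Set E) = -1 := by rw [dim, if_pos rfl]

lemma dim_nonneg_iff {A : Set E} : 0 ≤ dim A ↔ A.Nonempty := by
  rcases A.eq_empty_or_nonempty with rfl | hA
  · simp [dim_empty]
  · simp [dim_of_nonempty hA, hA]

lemma vectorSpan_le_ker {A : Set E} {k : Dual ℝ (E × ℝ)} (h : ∀ x ∈ A, k (x, 1) = 0) :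
    vectorSpan ℝ A ≤ LinearMap.ker (k ∘ₗ LinearMap.inl ℝ E ℝ) := by
  rw [vectorSpan_def, Submodule.span_le]
  rintro _ ⟨x, hx, y, hy, rfl⟩
  have := apply_sub_apply k x y
  rw [h x hx, h y hy, sub_zero] at this
  simpa using this.symm

variable [FiniteDimensional ℝ E]

lemma exists_eq_singleton_of_dim_eq_zero {A : Set E} (hA : dim A = 0) : ∃ x, A = {x} := by
  have hne : A.Nonempty := dim_nonneg_iff.1 hA.ge
  rw [dim_of_nonempty hne] at hA
  have hbot : vectorSpan ℝ A = ⊥ := Submodule.finrank_eq_zero.1 (by exact_mod_cast hA)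
  obtain ⟨x, hx⟩ := hne
  refine ⟨x, Set.eq_singleton_iff_unique_mem.2 ⟨hx, fun y hy => ?_⟩⟩
  have := vsub_mem_vectorSpan ℝ hy hx
  rw [hbot, Submodule.mem_bot, vsub_eq_sub, sub_eq_zero] at this
  exact this

lemma IsPolytope.mem_vertices_iff {P : Set E} (hP : IsPolytope P) {A : Set E} :
    A ∈ vertices P ↔ ∃ v ∈ P.extremePoints ℝ, A = {v} := by
  constructor
  · rintro ⟨hA, hdim⟩
    obtain ⟨v, rfl⟩ := exists_eq_singleton_of_dim_eq_zero hdim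
    exact ⟨v, isExtreme_singleton.1 hA.isExtreme, rfl⟩
  · rintro ⟨v, hv, rfl⟩
    obtain ⟨f, hfv, hf⟩ := hP.exists_functional_of_extremePoint hv
    have hnonneg : ∀ x ∈ P, 0 ≤ f (x, 1) := by
      rw [← hP.convexHull_extremePoints]
      refine nonneg_on_convexHull fun s hs => ?_
      by_cases hsv : s = v
      · rw [hsv, hfv]
      · exact (hf s hs hsv).le
    have hexp := isExposed_setOf_eq_zero hnonneg
    have hset : {x ∈ P | f (x, 1) = 0} = {v} := by
      have hinter : {x ∈ P | f (x, 1) = 0} ∩ P.extremePoints ℝ = {v} := by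
        refine Set.eq_singleton_iff_unique_mem.2 ⟨⟨⟨extremePoints_subset hv, hfv⟩, hv⟩, ?_⟩
        rintro s ⟨⟨-, hs0⟩, hs⟩
        by_contra hsv
        exact (hf s hs hsv).ne' hs0
      rw [← hP.convexHull_extremePoints_inter hexp, hinter, convexHull_singleton]
    refine ⟨hset ▸ hexp, ?_⟩
    rw [dim_of_nonempty (Set.singleton_nonempty v)]
    simp

/-! ### Facets and facet functionals -/

lemma finrank_inf_ker_add_one {W : Submodule ℝ E} {l : Dual ℝ E} {w : E} (hw : w ∈ W)
    (hlw : l w ≠ 0) :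
    Module.finrank ℝ (W ⊓ LinearMap.ker l : Submodule ℝ E) + 1 = Module.finrank ℝ W := by
  have hne : l.domRestrict W ≠ 0 := fun h => hlw (LinearMap.congr_fun h ⟨w, hw⟩)
  rw [← Module.Dual.finrank_ker_add_one_of_ne_zero hne, LinearMap.ker_domRestrict,
    ← Submodule.finrank_map_subtype_eq, Submodule.map_comap_subtype]

/-- The zero set of a facet functional is a facet. -/
lemma IsFacetFunctional.setOf_eq_zero_mem_facets {P : Set E} (hP : IsPolytope P)
    {g : Dual ℝ (E × ℝ)} (hg : IsFacetFunctional (homogenize (P.extremePoints ℝ)) g) :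
    {x ∈ P | g (x, 1) = 0} ∈ facets P := by
  set F := {x ∈ P | g (x, 1) = 0} with hF
  have hnonneg : ∀ x ∈ P, 0 ≤ g (x, 1) := by
    rw [← hP.convexHull_extremePoints]
    exact nonneg_on_convexHull (forall_mem_homogenize.1 hg.nonneg)
  obtain ⟨_, ⟨s₀, hs₀, rfl⟩, hgs₀⟩ := hg.ne_zero
  have hs₀P := extremePoints_subset hs₀
  have huniq : ∀ h : Dual ℝ (E × ℝ), (∀ x ∈ F, h (x, 1) = 0) →
      ∃ c : ℝ, ∀ x ∈ P, (h - c • g) (x, 1) = 0 := by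
    intro h hh
    obtain ⟨c, hc⟩ := hg.unique h (forall_mem_homogenize.2 fun x hx hgx =>
      hh x ⟨extremePoints_subset hx, hgx⟩)
    refine ⟨c, ?_⟩
    rw [← hP.convexHull_extremePoints]
    refine eq_zero_on_convexHull fun x hx => ?_
    simp [hc _ (mem_homogenize hx)]
  refine ⟨isExposed_setOf_eq_zero hnonneg, ?_⟩
  rw [dim_of_nonempty ⟨s₀, hs₀P⟩]
  rcases F.eq_empty_or_nonempty with hemp | ⟨x₀, hx₀⟩
  · -- If there are no zeros, then all affine functionals are proportional: `P` is a point.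
    have hsub : ∀ x ∈ P, x = s₀ := by
      intro x hx
      rw [← sub_eq_zero, ← Module.forall_dual_apply_eq_zero_iff ℝ]
      intro l
      obtain ⟨c, hc⟩ := huniq (l ∘ₗ LinearMap.fst ℝ E ℝ - l s₀ • LinearMap.snd ℝ E ℝ)
        (by simp [hemp])
      have hc0 : c = 0 := by simpa [hgs₀] using hc s₀ hs₀P
      simpa [hc0] using hc x hx
    have hPs : P = {s₀} := Set.eq_singleton_iff_unique_mem.2 ⟨hs₀P, hsub⟩
    rw [hemp, dim_empty, hPs, vectorSpan_singleton, finrank_bot]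
    norm_num
  · set l : Dual ℝ E := g ∘ₗ LinearMap.inl ℝ E ℝ with hl
    have hspan : vectorSpan ℝ F = vectorSpan ℝ P ⊓ LinearMap.ker l := by
      refine le_antisymm (le_inf (vectorSpan_mono ℝ fun x hx => hx.1)
        (vectorSpan_le_ker fun x hx => hx.2)) ?_
      rintro y ⟨hyP, hyl⟩
      by_contra hyF
      obtain ⟨k, hky, hk⟩ := Submodule.exists_le_ker_of_notMem hyF
      obtain ⟨c, hc⟩ := huniq (k ∘ₗ LinearMap.fst ℝ E ℝ - k x₀ • LinearMap.snd ℝ E ℝ) fun x hx => by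
        have : x - x₀ ∈ LinearMap.ker k := hk (vsub_mem_vectorSpan ℝ hx hx₀)
        simpa using this
      have h1 := vectorSpan_le_ker hc hyP
      have h2 : g (y, 0) = 0 := hyl
      exact hky (by simpa [h2] using h1)
    have hw : s₀ - x₀ ∈ vectorSpan ℝ P := vsub_mem_vectorSpan ℝ hs₀P hx₀.1
    have hlw : l (s₀ - x₀) ≠ 0 := by
      have := apply_sub_apply g s₀ x₀
      rw [hx₀.2, sub_zero] at this
      simpa [hl, this, -map_sub] using hgs₀
    rw [dim_of_nonempty ⟨x₀, hx₀⟩, hspan, ← finrank_inf_ker_add_one hw hlw]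
    push_cast
    ring

/-- Every facet is the zero set of a facet functional. -/
lemma IsPolytope.exists_isFacetFunctional_of_mem_facets {P : Set E} (hP : IsPolytope P)
    (hne : P.Nonempty) {F : Set E} (hF : F ∈ facets P) :
    ∃ g : Dual ℝ (E × ℝ), IsFacetFunctional (homogenize (P.extremePoints ℝ)) g ∧
      F = {x ∈ P | g (x, 1) = 0} := by
  obtain ⟨hexp, hdim⟩ := hF
  obtain ⟨v₀, hv₀⟩ : (P.extremePoints ℝ).Nonempty := by
    rw [← convexHull_nonempty_iff (𝕜 := ℝ), hP.convexHull_extremePoints]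
    exact hne
  rcases F.eq_empty_or_nonempty with rfl | hFne
  · -- The empty set is a facet of a point only; the functional is a positive constant.
    rw [dim_empty] at hdim
    obtain ⟨p, rfl⟩ := exists_eq_singleton_of_dim_eq_zero (A := P) (by linarith)
    refine ⟨LinearMap.snd ℝ E ℝ, ⟨?_, ?_, ?_⟩, by simp⟩
    · exact forall_mem_homogenize.2 fun x _ => by simp
    · exact ⟨_, mem_homogenize hv₀, by simp⟩
    · intro h _
      refine ⟨h (p, 1), forall_mem_homogenize.2 fun x hx => ?_⟩
      rw [Set.mem_singleton_iff.1 (extremePoints_subset hx)]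
      simp
  · obtain ⟨g, hnonneg, hFg⟩ := exists_eq_setOf_eq_zero hexp hFne
    refine ⟨g, ?_, hFg⟩
    set l : Dual ℝ E := g ∘ₗ LinearMap.inl ℝ E ℝ with hl
    obtain ⟨x₀, hx₀⟩ := hFne
    have hx₀' : x₀ ∈ P ∧ g (x₀, 1) = 0 := by rw [hFg] at hx₀; exact hx₀
    obtain ⟨s₀, hs₀, hgs₀⟩ : ∃ s ∈ P.extremePoints ℝ, g (s, 1) ≠ 0 := by
      by_contra! hzero
      have hFP : F = P := by
        rw [hFg]
        refine Set.sep_eq_self_iff_mem_true.2 ?_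
        rw [← hP.convexHull_extremePoints]
        exact eq_zero_on_convexHull hzero
      rw [hFP] at hdim
      linarith
    have hw : s₀ - x₀ ∈ vectorSpan ℝ P :=
      vsub_mem_vectorSpan ℝ (extremePoints_subset hs₀) hx₀'.1
    have hlw : l (s₀ - x₀) = g (s₀, 1) := by
      have := apply_sub_apply g s₀ x₀
      rw [hx₀'.2, sub_zero] at this
      simpa [hl, -map_sub] using this.symm
    have hspan : vectorSpan ℝ F = vectorSpan ℝ P ⊓ LinearMap.ker l := by
      refine Submodule.eq_of_le_of_finrank_eq (le_inf (vectorSpan_mono ℝ hexp.subset)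
        (vectorSpan_le_ker fun x hx => by rw [hFg] at hx; exact hx.2)) ?_
      rw [dim_of_nonempty hne, dim_of_nonempty ⟨x₀, hx₀⟩,
        ← finrank_inf_ker_add_one hw (hlw ▸ hgs₀)] at hdim
      push_cast at hdim
      have : (Module.finrank ℝ (vectorSpan ℝ F) : ℤ) =
        Module.finrank ℝ (vectorSpan ℝ P ⊓ LinearMap.ker l : Submodule ℝ E) := by linarith
      exact_mod_cast this
    refine ⟨forall_mem_homogenize.2 fun x hx => hnonneg x (extremePoints_subset hx),
      ⟨_, mem_homogenize hs₀, hgs₀⟩, fun h hh => ?_⟩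
    have hhF : ∀ x ∈ F, h (x, 1) = 0 := by
      rw [← hP.convexHull_extremePoints_inter hexp]
      refine eq_zero_on_convexHull fun x hx => forall_mem_homogenize.1 hh x hx.2 ?_
      have := hx.1
      rw [hFg] at this
      exact this.2
    refine ⟨h (s₀ - x₀, 0) / g (s₀, 1), forall_mem_homogenize.2 fun x hx => ?_⟩
    -- Project `x - x₀` along `s₀ - x₀` to the directions of the facet, on which `h` is constant.
    set t := g (x, 1) / g (s₀, 1) with ht
    have hlx : l (x - x₀) = g (x, 1) := by
      have := apply_sub_apply g x x₀
      rw [hx₀'.2, sub_zero] at this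
      simpa [hl, -map_sub] using this.symm
    have hy : (x - x₀) - t • (s₀ - x₀) ∈ vectorSpan ℝ F := by
      rw [hspan]
      refine ⟨sub_mem (vsub_mem_vectorSpan ℝ (extremePoints_subset hx) hx₀'.1)
        (Submodule.smul_mem _ _ hw), ?_⟩
      rw [SetLike.mem_coe, LinearMap.mem_ker, map_sub, map_smul, hlx, hlw, smul_eq_mul, ht,
        div_mul_cancel₀ _ hgs₀, sub_self]
    have hhy := LinearMap.mem_ker.1 (vectorSpan_le_ker hhF hy)
    have hhx : h (x, 1) = h (x - x₀, 0) := by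
      rw [← apply_sub_apply, hhF x₀ hx₀, sub_zero]
    rw [map_sub, map_smul, smul_eq_mul] at hhy
    simp only [LinearMap.comp_apply, LinearMap.inl_apply] at hhy
    rw [hhx, sub_eq_zero.1 hhy, ht]
    ring

end Faces

/-! ### The slack matrix -/

section Slack

variable {E : Type*} [NormedAddCommGroup E] [NormedSpace ℝ E]

/-- The span of the cone over `P` has dimension at most `dim P + 1`. -/
lemma finrank_span_homogenize_le [FiniteDimensional ℝ E] {P : Set E} (hne : P.Nonempty) :
    (Module.finrank ℝ (Submodule.span ℝ (homogenize P)) : ℤ) ≤ dim P + 1 := by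
  obtain ⟨x₀, hx₀⟩ := hne
  rw [dim_of_nonempty ⟨x₀, hx₀⟩]
  have hle : Submodule.span ℝ (homogenize P) ≤
      (vectorSpan ℝ P).map (LinearMap.inl ℝ E ℝ) ⊔ Submodule.span ℝ {(x₀, (1 : ℝ))} := by
    rw [Submodule.span_le]
    rintro _ ⟨x, hx, rfl⟩
    refine Submodule.mem_sup.2 ⟨(x - x₀, 0), ⟨x - x₀, vsub_mem_vectorSpan ℝ hx hx₀, rfl⟩,
      (x₀, 1), Submodule.mem_span_singleton_self _, by simp⟩
  have h1 := Submodule.finrank_mono hle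
  have h2 := Submodule.finrank_add_le_finrank_add_finrank
    ((vectorSpan ℝ P).map (LinearMap.inl ℝ E ℝ)) (Submodule.span ℝ {(x₀, (1 : ℝ))})
  have h3 := Submodule.finrank_map_le (LinearMap.inl ℝ E ℝ) (vectorSpan ℝ P)
  have h4 := finrank_span_singleton (K := ℝ) (v := (x₀, (1 : ℝ))) (by simp)
  have : Module.finrank ℝ (Submodule.span ℝ (homogenize P)) ≤
    Module.finrank ℝ (vectorSpan ℝ P) + 1 := by omega
  exact_mod_cast this

lemma IsPolytope.finite_vertices [FiniteDimensional ℝ E] {P : Set E} (hP : IsPolytope P) :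
    (vertices P).Finite :=
  (hP.finite_extremePoints.image fun v => ({v} : Set E)).subset fun A hA => by
    obtain ⟨v, hv, rfl⟩ := hP.mem_vertices_iff.1 hA
    exact ⟨v, hv, rfl⟩

lemma IsPolytope.finite_facets {P : Set E} (hP : IsPolytope P) : (facets P).Finite :=
  (hP.finite_extremePoints.finite_subsets.image (convexHull ℝ)).subset fun F hF =>
    ⟨F ∩ P.extremePoints ℝ, Set.inter_subset_right, hP.convexHull_extremePoints_inter hF.1⟩

/-- A nonempty polytope has a slack matrix: a matrix with extreme rows and columns, indexed by the
vertices and the facets, of rank at most `dim P + 1`, whose zeros are the incidences. -/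
lemma IsPolytope.exists_slackMatrix [FiniteDimensional ℝ E] {P : Set E} (hP : IsPolytope P)
    (hne : P.Nonempty) [Fintype (vertices P)] [Fintype (facets P)] :
    ∃ M : vertices P → facets P → ℝ, HasExtremeRows M ∧ HasExtremeRows (fun F v => M v F) ∧
      ((Matrix.of M).rank : ℤ) ≤ dim P + 1 ∧ ∀ v F, M v F = 0 ↔ (v : Set E) ⊆ F := by
  classical
  choose p hp hvp using fun v : vertices P => hP.mem_vertices_iff.1 v.2
  choose g hg hFg using fun F : facets P => hP.exists_isFacetFunctional_of_mem_facets hne F.2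
  set S := P.extremePoints ℝ with hS
  have hSfin : (homogenize S).Finite := hP.finite_extremePoints.image _
  have hp_surj : ∀ x ∈ S, ∃ v, p v = x := fun x hx => by
    refine ⟨⟨{x}, hP.mem_vertices_iff.2 ⟨x, hx, rfl⟩⟩, ?_⟩
    exact (Set.singleton_eq_singleton_iff.1 (hvp ⟨{x}, _⟩)).symm
  have hp_inj : Function.Injective p := fun v w hvw => Subtype.ext (by rw [hvp, hvp w, hvw])
  -- Up to a factor, the chosen functionals are all facet functionals.
  have hall : ∀ k, IsFacetFunctional (homogenize S) k →
      ∃ F c, c ≠ 0 ∧ ∀ q ∈ Submodule.span ℝ (homogenize S), k q = c * g F q := by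
    intro k hk
    let F : facets P := ⟨_, hk.setOf_eq_zero_mem_facets hP⟩
    obtain ⟨c, hc⟩ := (hg F).unique k (forall_mem_homogenize.2 fun x hx hgx => by
      have : x ∈ (F : Set E) := by
        rw [hFg F]
        exact ⟨extremePoints_subset hx, hgx⟩
      exact this.2)
    refine ⟨F, c, ?_, fun q hq => ?_⟩
    · rintro rfl
      obtain ⟨s, hs, hks⟩ := hk.ne_zero
      exact hks (by rw [hc s hs, zero_mul])
    · have hle : Submodule.span ℝ (homogenize S) ≤ LinearMap.ker (k - c • g F) :=
        Submodule.span_le.2 fun s hs => by simp [hc s hs]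
      have := LinearMap.mem_ker.1 (hle hq)
      simpa [sub_eq_zero] using this
  have hmem : ∀ v, (p v, (1 : ℝ)) ∈ homogenize S := fun v => mem_homogenize (hp v)
  let L : E × ℝ →ₗ[ℝ] (facets P → ℝ) := LinearMap.pi g
  have hspan : Submodule.span ℝ (Set.range fun v F => g F (p v, 1)) ≤
      (Submodule.span ℝ (homogenize S)).map L := by
    rw [Submodule.span_le]
    rintro _ ⟨v, rfl⟩
    exact ⟨_, Submodule.subset_span (hmem v), rfl⟩
  have hrow : ∀ v, ∀ q ∈ Submodule.span ℝ (homogenize S),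
      (∀ F, g F (p v, 1) = 0 → g F q = 0) → ∃ c : ℝ, q = c • (p v, (1 : ℝ)) := by
    intro v q hq hz
    obtain ⟨f, hfv, hf⟩ := hP.exists_functional_of_extremePoint (hp v)
    refine exists_eq_smul_of_forall_isFacetFunctional hSfin (f := f)
      (forall_mem_homogenize.2 fun s hs hne => hf s hs fun h => hne (by rw [h])) hfv hq ?_ (hmem v)
    intro k hk hkv
    obtain ⟨F, c, hc0, hc⟩ := hall k hk
    rw [hc _ (Submodule.subset_span (hmem v))] at hkv
    rw [hc q hq, hz F ((mul_eq_zero.1 hkv).resolve_left hc0), mul_zero]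
  refine ⟨fun v F => g F (p v, 1), ⟨?_, ?_, ?_, ?_⟩, ⟨?_, ?_, ?_, ?_⟩, ?_, ?_⟩
  · exact fun v F => (hg F).nonneg _ (hmem v)
  · -- Some facet misses the vertex, because the height functional separates `-(p v, 1)`.
    intro v hv0
    obtain ⟨k, hk, -, hkv⟩ := exists_isFacetFunctional hSfin
      (neg_mem (Submodule.subset_span (hmem v))) (f := LinearMap.snd ℝ E ℝ)
      (forall_mem_homogenize.2 fun x _ => by simp) (by simp)
    obtain ⟨F, c, -, hc⟩ := hall k hk
    have h0 : g F (p v, 1) = 0 := congrFun hv0 F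
    rw [map_neg, hc _ (Submodule.subset_span (hmem v)), h0] at hkv
    simp at hkv
  · intro u v c huv
    obtain ⟨d, hd⟩ := hrow v (p u, 1) (Submodule.subset_span (hmem u)) fun F hF => by
      have : g F (p u, 1) = c * g F (p v, 1) := congrFun huv F
      rw [this, hF, mul_zero]
    have hd1 : d = 1 := by simpa using (congrArg Prod.snd hd).symm
    exact hp_inj (by simpa [hd1] using congrArg Prod.fst hd)
  · intro v x hx hz
    obtain ⟨q, hq, rfl⟩ := hspan hx
    obtain ⟨c, rfl⟩ := hrow v q hq hz
    exact ⟨c, by rw [map_smul]; rfl⟩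
  · exact fun F v => (hg F).nonneg _ (hmem v)
  · intro F hF0
    obtain ⟨_, ⟨x, hx, rfl⟩, hgx⟩ := (hg F).ne_zero
    obtain ⟨v, rfl⟩ := hp_surj x hx
    exact hgx (congrFun hF0 v)
  · intro F G c hFG
    have hc : ∀ x ∈ S, g F (x, 1) = c * g G (x, 1) := fun x hx => by
      obtain ⟨v, rfl⟩ := hp_surj x hx
      exact congrFun hFG v
    have hc0 : c ≠ 0 := by
      rintro rfl
      obtain ⟨_, ⟨x, hx, rfl⟩, hgx⟩ := (hg F).ne_zero
      exact hgx ((hc x hx).trans (zero_mul _))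
    have hinter : (F : Set E) ∩ S = (G : Set E) ∩ S := by
      rw [hFg F, hFg G]
      ext x
      constructor
      · rintro ⟨⟨hxP, hx0⟩, hx⟩
        rw [hc x hx] at hx0
        exact ⟨⟨hxP, (mul_eq_zero.1 hx0).resolve_left hc0⟩, hx⟩
      · rintro ⟨⟨hxP, hx0⟩, hx⟩
        exact ⟨⟨hxP, by rw [hc x hx, hx0, mul_zero]⟩, hx⟩
    refine Subtype.ext ?_
    rw [← hP.convexHull_extremePoints_inter F.2.1, hinter,
      hP.convexHull_extremePoints_inter G.2.1]
  · -- The column space consists of restrictions of functionals, and those vanishing on the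
    -- vertices of a facet are multiples of its functional.
    intro F x hx hz
    let R : Dual ℝ (E × ℝ) →ₗ[ℝ] (vertices P → ℝ) :=
      LinearMap.pi fun v => LinearMap.applyₗ (p v, (1 : ℝ))
    have hle : Submodule.span ℝ (Set.range fun F v => g F (p v, 1)) ≤ LinearMap.range R := by
      rw [Submodule.span_le]
      rintro _ ⟨F, rfl⟩
      exact ⟨g F, rfl⟩
    obtain ⟨h, rfl⟩ := hle hx
    obtain ⟨c, hc⟩ := (hg F).unique h (forall_mem_homogenize.2 fun x hx hgx => by
      obtain ⟨v, rfl⟩ := hp_surj x hx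
      exact hz v hgx)
    exact ⟨c, funext fun v => hc _ (hmem v)⟩
  · have h1 : (Matrix.of fun v F => g F (p v, 1)).rank ≤
        Module.finrank ℝ (Submodule.span ℝ (homogenize P)) := by
      rw [Matrix.rank_eq_finrank_span_row]
      refine (Submodule.finrank_mono hspan).trans ((Submodule.finrank_map_le _ _).trans ?_)
      exact Submodule.finrank_mono (Submodule.span_mono (Set.image_mono extremePoints_subset))
    exact (Int.ofNat_le.2 h1).trans (finrank_span_homogenize_le hne)
  · intro v F
    rw [hvp v, Set.singleton_subset_iff, hFg F]
    exact ⟨fun h => ⟨extremePoints_subset (hp v), h⟩, fun h => h.2⟩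

end Slack

/-! ### The assignment -/

lemma exists_isMatching_of_injective {W ι : Type*} {G : SimpleGraph W} {a b : ι → W}
    (ha : Function.Injective a) (hb : Function.Injective b) (hab : ∀ i j, a i ≠ b j)
    (hadj : ∀ i, G.Adj (a i) (b i)) :
    ∃ m : G.Subgraph, (∀ i, a i ∈ m.verts) ∧ m.IsMatching := by
  have hdisj : Disjoint (Set.range a) (Set.range b) := by
    rw [Set.disjoint_left]
    rintro _ ⟨i, rfl⟩ ⟨j, hj⟩
    exact hab i j hj.symm
  obtain ⟨m, hm, hmatch⟩ := SimpleGraph.Subgraph.IsMatching.exists_of_disjoint_sets_of_equiv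
    (G := G) hdisj ((Equiv.ofInjective a ha).symm.trans (Equiv.ofInjective b hb)) (by
      rintro ⟨_, i, rfl⟩
      have : (Equiv.ofInjective a ha).symm ⟨a i, i, rfl⟩ = i :=
        (Equiv.ofInjective a ha).symm_apply_apply i
      simpa [this] using hadj i)
  exact ⟨m, fun i => hm ▸ Or.inl ⟨i, rfl⟩, hmatch⟩

lemma IsPolytope.hasVertexFacetAssignment {E : Type*} [NormedAddCommGroup E] [NormedSpace ℝ E]
    [FiniteDimensional ℝ E] {P : Set E} (hP : IsPolytope P) (hdim : dim P ≤ 6) :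
    HasVertexFacetAssignment P := by
  rcases P.eq_empty_or_nonempty with rfl | hne
  · -- The empty polytope has no vertices, so the empty matching covers all of them.
    refine ⟨⊥, fun v hv => hv.elim, Or.inl fun v => ?_⟩
    obtain ⟨x, hx, -⟩ := hP.mem_vertices_iff.1 v.2
    exact (extremePoints_subset hx).elim
  have := hP.finite_vertices.fintype
  have := hP.finite_facets.fintype
  obtain ⟨M, hrow, hcol, hrank, hM⟩ := hP.exists_slackMatrix hne
  have hrank7 : (Matrix.of M).rank ≤ 7 := by
    have : ((Matrix.of M).rank : ℤ) ≤ 7 := by linarith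
    exact_mod_cast this
  rcases le_total (Fintype.card (vertices P)) (Fintype.card (facets P)) with hle | hle
  · obtain ⟨φ, hφ, hMφ⟩ := exists_injective_of_card_le hrow hcol hrank7 hle
    obtain ⟨m, hm, hmatch⟩ := exists_isMatching_of_injective (G := vertexFacetGraph P)
      Sum.inl_injective (Sum.inr_injective.comp hφ) (fun _ _ => Sum.inl_ne_inr)
      (fun v hv => hMφ v ((hM v (φ v)).2 hv))
    exact ⟨m, hmatch, Or.inl hm⟩
  · have hrank7' : (Matrix.of fun F v => M v F).rank ≤ 7 := by
      rwa [← Matrix.rank_transpose] at hrank7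
    obtain ⟨φ, hφ, hMφ⟩ := exists_injective_of_card_le hcol hrow hrank7' hle
    obtain ⟨m, hm, hmatch⟩ := exists_isMatching_of_injective (G := vertexFacetGraph P)
      Sum.inr_injective (Sum.inl_injective.comp hφ) (fun _ _ => Sum.inr_ne_inl)
      (fun F hF => hMφ F ((hM (φ F) F).2 hF))
    exact ⟨m, hmatch, Or.inr hm⟩

end PolytopeAssignment

theorem mainTheorem3 (n : ℕ) (P : Set (EuclideanSpace ℝ (Fin n)))
    (hP : PolytopeAssignment.IsPolytope P) (hdim : PolytopeAssignment.dim P ≤ 6) :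
    PolytopeAssignment.HasVertexFacetAssignment P :=
  hP.hasVertexFacetAssignment hdim
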